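/- Let $E_{\max}\ge 0$ and $\Delta_{\max}\ge 1$ be integers, $0<\beta<1$ and $p,q,p_s\in[0,1]$. Consider the Markov decision process with states $S=(e,X,\Delta)\in\mathfrak S=\{0,\dots,E_{\max}\}\times\{0,1\}\times\{0,\dots,\Delta_{\max}\}$ (battery level, source state, Version Innovation Age), actions $a\in\{0,1\}$ (idle, transmit), cost $\Delta$ in every state $S=(e,X,\Delta)$, and the following transitions. In each slot there are independently an energy arrival $b\in\{0,1\}$ with $\Pr[b=1]=\beta$, a channel state $h\in\{0,1\}$ with $\Pr[h=1]=p_s$, and a source transition $X\to X'$, which goes from $0$ to $1$ with probability $p$ and from $1$ to $0$ with probability $q$. Put $\alpha=a$ if $e>0$ and $\alpha=0$ if $e=0$. Then $e'=\min\{e+b-\alpha,E_{\max}\}$; if $\alpha=h=1$, then $\Delta'=0$ when $X'=X$ and $\Delta'=1$ when $X'\ne X$; otherwise $\Delta'=\Delta$ when $X'=X$ and $\Delta'=\min\{\Delta+1,\Delta_{\max}\}$ when $X'\neq X$. For a causal (history-dependent, possibly randomized) policy $\pi$ and an initial state $s$ let $$J(\pi,s)=\limsup_{T\to\infty}\frac1T\,E^{\pi}\Big[\sum_{t=1}^T\Delta_t\,\Big|\,S_1=s\Big].$$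 Assume that $p>0$ and $q>0$, or that $p_s>0$ and $E_{\max}\ge1$. Then there is a real number $\theta^*$ such that: (i) $\min_\pi J(\pi,s)=\theta^*$ for every initial state $s\in\mathfrak S$, and in particular the minimum is attained; (ii) there is a function $V:\mathfrak S\to\mathbb R$ that satisfies, together with $\theta=\theta^*$, the Bellman equation $$\theta+V(S)=\min_{a\in\{0,1\}}\Big\{\Delta+\sum_{S'\in\mathfrak S}\Pr[S'\mid S,a]\,V(S')\Big\}\qquad\text{for all } S=(e,X,\Delta)\in\mathfrak S;$$ (iii) whenever $\theta\in\mathbb R$ and $V:\mathfrak S\to\mathbb R$ satisfy this Bellman equation, $\theta=\theta^*$, and every stationary deterministic policy $\pi^*:\mathfrak S\to\{0,1\}$ with $$\pi^*(S)\in\operatorname*{argmin}_{a\in\{0,1\}}\Big\{\Delta+\sum_{S'\in\mathfrak S}\Pr[S'\mid S,a]\,V(S')\Big\}\qquad\text{for all } S\in\mathfrak S$$ is optimal from every initial state, that is, $J(\pi^*,s)=\theta^*$ for all $s\in\mathfrak S$. -/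

import Mathlib

/-- The parameters of the monitoring system: battery capacity `Emax`, maximal Version Innovation
Age `Dmax`, source transition probabilities `p` (from 0 to 1) and `q` (from 1 to 0), success
probability `ps` of a transmission, energy-arrival probability `β`. -/
structure VIAModel where
  Emax : ℕ
  Dmax : ℕ
  p : ℝ
  q : ℝ
  ps : ℝ
  β : ℝ

namespace VIAModel

/-- States `(e, X, Δ)`: battery level, source state (`false` is 0, `true` is 1), VIA. -/
abbrev State (M : VIAModel) : Type := Fin (M.Emax + 1) × Bool × Fin (M.Dmax + 1)

/-- Actions: `true` is 1 (transmit), `false` is 0 (remain idle). -/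
abbrev Action : Type := Bool

/-- The Bernoulli weights with `Pr[true] = r`. -/
noncomputable def bern (r : ℝ) (b : Bool) : ℝ := if b then r else 1 - r

/-- `Pr[X_{t+1} = x' | X_t = x]` for the two-state source. -/
noncomputable def sourceProb (M : VIAModel) (x x' : Bool) : ℝ :=
  match x, x' with
  | false, false => 1 - M.p
  | false, true => M.p
  | true, false => M.q
  | true, true => 1 - M.q

/-- A transmission takes place when the action is 1 and the battery is not empty. -/
def transmits (M : VIAModel) (s : State M) (a : Action) : Bool := a && decide (0 < s.1.val)

/-- Battery level in the next slot, `min {e + b - α, Emax}`. The subtraction never truncates, since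
`α = 1` only when `e ≥ 1`. -/
def nextBattery (M : VIAModel) (s : State M) (a : Action) (b : Bool) : ℕ :=
  min (s.1.val + b.toNat - (M.transmits s a).toNat) M.Emax

/-- VIA in the next slot, given the channel state `h` and the next source state `x'`. -/
def nextVIA (M : VIAModel) (s : State M) (a : Action) (h x' : Bool) : ℕ :=
  if M.transmits s a = true ∧ h = true then
    (if x' = s.2.1 then 0 else 1)
  else
    (if x' = s.2.1 then s.2.2.val else min (s.2.2.val + 1) M.Dmax)

/-- The next state, given the energy arrival `b`, the channel state `h` and the next source state.
The outer minimum in the last component changes nothing as soon as `1 ≤ Dmax`. -/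
def nextState (M : VIAModel) (s : State M) (a : Action) (b h x' : Bool) : State M :=
  (⟨M.nextBattery s a b, Nat.lt_succ_of_le (Nat.min_le_right _ _)⟩, x',
    ⟨min (M.nextVIA s a h x') M.Dmax, Nat.lt_succ_of_le (Nat.min_le_right _ _)⟩)

/-- The transition probability `Pr[s' | s, a]`: energy arrival, channel state and source transition
are independent. -/
noncomputable def transProb (M : VIAModel) (s : State M) (a : Action) (s' : State M) : ℝ :=
  ∑ b : Bool, ∑ h : Bool, ∑ x' : Bool,
    if M.nextState s a b h x' = s' then bern M.β b * bern M.ps h * M.sourceProb s.2.1 x' else 0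

/-- The cost of a state (under either action) is its VIA. -/
def cost (M : VIAModel) (s : State M) : ℝ := (s.2.2.val : ℝ)

/-- `Hist M n` is the set of histories `(S_1, α_1, S_2, …, α_n, S_{n+1})`. -/
def Hist (M : VIAModel) : ℕ → Type
  | 0 => State M
  | n + 1 => Hist M n × Action × State M

instance instFintypeHist (M : VIAModel) : (n : ℕ) → Fintype (Hist M n)
  | 0 => inferInstanceAs (Fintype (State M))
  | n + 1 =>
    letI := instFintypeHist M n
    inferInstanceAs (Fintype (Hist M n × Action × State M))

/-- The current (last) state of a history. -/
def Hist.last {M : VIAModel} : {n : ℕ} → Hist M n → State M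
  | 0, s => s
  | _ + 1, h => h.2.2

/-- Causal policies, history-dependent and possibly randomized: `π n h` is the probability of
choosing action 1 in slot `n + 1` after the history `h`. -/
abbrev Policy (M : VIAModel) : Type := (n : ℕ) → Hist M n → unitInterval

/-- The stationary deterministic policy that plays `μ S` in every state `S`. -/
def stationary {M : VIAModel} (μ : State M → Action) : Policy M :=
  fun _ h => if μ h.last = true then 1 else 0

/-- The law of the history up to slot `n + 1` under the policy `π`, given `S_1 = s`. -/
noncomputable def histProb (M : VIAModel) (π : Policy M) (s : State M) : (n : ℕ) → Hist M n → ℝ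
  | 0, s₁ => if (show State M from s₁) = s then 1 else 0
  | n + 1, (h, a, s') =>
    histProb M π s n h * bern (π n h : ℝ) a * M.transProb h.last a s'

/-- `E[Δ_{n+1} | S_1 = s]` under the policy `π`. -/
noncomputable def expCost (M : VIAModel) (π : Policy M) (s : State M) (n : ℕ) : ℝ :=
  ∑ h : Hist M n, M.histProb π s n h * M.cost h.last

/-- The average cost `limsup_{T → ∞} (1/T) E[∑_{t=1}^T Δ_t | S_1 = s]` of the policy `π`. All
terms lie in `[0, Dmax]`, so this is a genuine limsup of a bounded sequence. -/
noncomputable def avgCost (M : VIAModel) (π : Policy M) (s : State M) : ℝ :=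
  Filter.limsup (fun T : ℕ => (1 / (T : ℝ)) * ∑ n ∈ Finset.range T, M.expCost π s n) Filter.atTop

/-- `Δ + ∑_{S'} Pr[S' | S, a] V(S')` at `S = (e, X, Δ)`. -/
noncomputable def bellmanTerm (M : VIAModel) (V : State M → ℝ) (s : State M) (a : Action) : ℝ :=
  M.cost s + ∑ s' : State M, M.transProb s a s' * V s'

/-- The average-cost Bellman equation for the pair `(θ, V)`. -/
def Bellman (M : VIAModel) (θ : ℝ) (V : State M → ℝ) : Prop :=
  ∀ s : State M, θ + V s = min (M.bellmanTerm V s false) (M.bellmanTerm V s true)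

/-- The set of minimizing actions in the Bellman equation at the state `s`. -/
def argminActions (M : VIAModel) (V : State M → ℝ) (s : State M) : Set Action :=
  {a | ∀ a' : Action, M.bellmanTerm V s a ≤ M.bellmanTerm V s a'}

end VIAModel

/-!
The proof rests on a vanishing-discount argument for finite Markov decision processes with two
actions.

*Existence of a solution of the Bellman equation.* For every discount factor `γ < 1` the discounted
optimality equation has a solution `V_γ` (Banach). Subtract from `V_γ` its minimum and rescale: this
gives `ρ ≥ 0`, `θ` and `u ≥ 0` with `ρ + ‖u‖ = 1`, `|θ| ≤ K ρ`, `min u = 0` and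
`θ + u = min_a (ρ c + γ P_a u)`. These conditions are closed and bounded, so they survive along a
subsequence with `γ → 1`. If the limit has `ρ > 0`, then `(θ / ρ, u / ρ)` solves the average-cost
equation. If `ρ = 0`, then `θ = 0` and `u` is a nonconstant solution of `u = min_a P_a u`. Hence it
suffices to exclude such solutions (`FiniteMDP.exists_averageCost_solution`).

The set where a solution `w` of `w = min_a P_a w` is maximal is closed under every transition of
positive probability; from each point where it is minimal some action keeps it minimal almost
surely. When both source transitions have positive probability, the set of maximizers contains all
states of maximal age, while the set of minimizers contains at least one, since a source that flips
during a drought of energy drives the age to its maximum under every policy. So `w` is constant.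
When one source transition is impossible and transmissions can succeed, `w` need not be
constant in general (if `p = q = 0`, it may be any function of the source state); but the states
of age `0` with a source that never moves have discounted value `0`, so one may restrict to those `w`
that are minimal there, and some sequence of actions leads there with positive probability from
every state, in particular from a maximizer.

*Verification.* Summing the Bellman inequality along the history of an arbitrary policy telescopes
(`VIAModel.bellman_telescope_le`), so that the average cost up to time `T` is at least
`θ - 2 B / T` with `B` a bound on `V`; for a policy that plays minimizing actions all inequalities
are equalities. Thus `θ` is the minimal average cost for every solution `(θ, V)`, which also gives
the uniqueness of `θ`.
-/

open Filter Topology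

/-! ### Finite Markov decision processes with two actions -/

namespace FiniteMDP

variable {S : Type*} [Fintype S]

/-- The optimality equation of the `γ`-discounted problem with cost `c` and transition
probabilities `P s a s'`. -/
def IsDiscountedValue (c : S → ℝ) (P : S → Bool → S → ℝ) (γ : ℝ) (V : S → ℝ) : Prop :=
  ∀ s, V s = min (c s + γ * ∑ t, P s false t * V t) (c s + γ * ∑ t, P s true t * V t)

lemma average_le {p f : S → ℝ} {K : ℝ} (hp0 : ∀ t, 0 ≤ p t) (hp1 : ∑ t, p t = 1)
    (hf : ∀ t, p t ≠ 0 → f t ≤ K) : ∑ t, p t * f t ≤ K := by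
  calc ∑ t, p t * f t ≤ ∑ t, p t * K := by
        refine Finset.sum_le_sum fun t _ => ?_
        by_cases h : p t = 0
        · simp [h]
        · exact mul_le_mul_of_nonneg_left (hf t h) (hp0 t)
    _ = K := by rw [← Finset.sum_mul, hp1, one_mul]

lemma le_average {p f : S → ℝ} {k : ℝ} (hp0 : ∀ t, 0 ≤ p t) (hp1 : ∑ t, p t = 1)
    (hf : ∀ t, k ≤ f t) : k ≤ ∑ t, p t * f t := by
  have := average_le (f := fun t => -f t) (K := -k) hp0 hp1 fun t _ => neg_le_neg (hf t)
  simp only [mul_neg, Finset.sum_neg_distrib] at this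
  linarith

/-- An average that attains the maximum puts weight on maximal values only. -/
lemma eq_of_le_average {p f : S → ℝ} {K : ℝ} (hp0 : ∀ t, 0 ≤ p t) (hp1 : ∑ t, p t = 1)
    (hf : ∀ t, f t ≤ K) (h : K ≤ ∑ t, p t * f t) {t : S} (ht : 0 < p t) : f t = K := by
  have h0 : ∑ t, p t * (K - f t) ≤ 0 := by
    simp only [mul_sub, Finset.sum_sub_distrib, ← Finset.sum_mul, hp1, one_mul]
    linarith
  have hnn : ∀ t ∈ Finset.univ, 0 ≤ p t * (K - f t) := fun t _ =>
    mul_nonneg (hp0 t) (sub_nonneg.2 (hf t))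
  have := (Finset.sum_eq_zero_iff_of_nonneg hnn).1
    (le_antisymm h0 (Finset.sum_nonneg hnn)) t (Finset.mem_univ t)
  have := (mul_eq_zero.1 this).resolve_left ht.ne'
  linarith

lemma eq_of_average_le {p f : S → ℝ} {k : ℝ} (hp0 : ∀ t, 0 ≤ p t) (hp1 : ∑ t, p t = 1)
    (hf : ∀ t, k ≤ f t) (h : ∑ t, p t * f t ≤ k) {t : S} (ht : 0 < p t) : f t = k := by
  have := eq_of_le_average (f := fun t => -f t) (K := -k) hp0 hp1
    (fun t => neg_le_neg (hf t)) (by simpa using h) ht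
  linarith

variable {c : S → ℝ} {P : S → Bool → S → ℝ}

lemma exists_isDiscountedValue (hP0 : ∀ s a t, 0 ≤ P s a t) (hP1 : ∀ s a, ∑ t, P s a t = 1)
    {γ : ℝ} (hγ0 : 0 ≤ γ) (hγ1 : γ < 1) : ∃ V, IsDiscountedValue c P γ V := by
  let T : (S → ℝ) → S → ℝ := fun V s =>
    min (c s + γ * ∑ t, P s false t * V t) (c s + γ * ∑ t, P s true t * V t)
  have hT : ContractingWith ⟨γ, hγ0⟩ T := by
    refine ⟨by exact_mod_cast hγ1, LipschitzWith.of_dist_le_mul fun V W => ?_⟩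
    have key : ∀ s a, |(c s + γ * ∑ t, P s a t * V t) - (c s + γ * ∑ t, P s a t * W t)|
        ≤ γ * dist V W := by
      intro s a
      rw [add_sub_add_left_eq_sub, ← mul_sub, ← Finset.sum_sub_distrib, abs_mul,
        abs_of_nonneg hγ0]
      refine mul_le_mul_of_nonneg_left ?_ hγ0
      calc |∑ t, (P s a t * V t - P s a t * W t)|
          ≤ ∑ t, |P s a t * V t - P s a t * W t| := Finset.abs_sum_le_sum_abs _ _
        _ = ∑ t, P s a t * dist (V t) (W t) := by
            refine Finset.sum_congr rfl fun t _ => ?_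
            rw [← mul_sub, abs_mul, abs_of_nonneg (hP0 s a t), Real.dist_eq]
        _ ≤ dist V W := average_le (hP0 s a) (hP1 s a) fun t _ => dist_le_pi_dist V W t
    refine (dist_pi_le_iff (mul_nonneg hγ0 dist_nonneg)).2 fun s => ?_
    rw [Real.dist_eq]
    exact (abs_min_sub_min_le_max _ _ _ _).trans (max_le (key s false) (key s true))
  exact ⟨hT.fixedPoint T, fun s => (congrFun hT.fixedPoint_isFixedPt s).symm⟩

/-- States of a cost-free set that can be kept forever by playing `false` have the least possible
discounted value, namely `0`. -/
lemma IsDiscountedValue.le_of_mem_costFree [Nonempty S] (hP0 : ∀ s a t, 0 ≤ P s a t)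
    (hP1 : ∀ s a, ∑ t, P s a t = 1) (hc : ∀ s, 0 ≤ c s) {Z : Set S} (hZc : ∀ z ∈ Z, c z = 0)
    (hZ : ∀ z ∈ Z, ∀ t, P z false t ≠ 0 → t ∈ Z) {γ : ℝ} (hγ0 : 0 ≤ γ) (hγ1 : γ < 1)
    {V : S → ℝ} (hV : IsDiscountedValue c P γ V) {z : S} (hz : z ∈ Z) (s : S) : V z ≤ V s := by
  have hmin : ∀ s, 0 ≤ V s := by
    obtain ⟨x, hx⟩ := Finite.exists_min V
    have h : γ * V x ≤ V x := by
      conv_rhs => rw [hV x]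
      have := fun a => mul_le_mul_of_nonneg_left (le_average (hP0 x a) (hP1 x a) hx) hγ0
      exact le_min (by linarith [this false, hc x]) (by linarith [this true, hc x])
    have : 0 ≤ V x := by
      by_contra hneg
      nlinarith
    exact fun s => this.trans (hx s)
  obtain ⟨y, hyZ, hy⟩ := Set.exists_max_image Z V Z.toFinite ⟨z, hz⟩
  have h : V y ≤ γ * V y := by
    have h1 : V y ≤ c y + γ * ∑ t, P y false t * V t := (hV y).trans_le (min_le_left _ _)
    have h2 := mul_le_mul_of_nonneg_left
      (average_le (hP0 y false) (hP1 y false) fun t ht => hy t (hZ y hyZ t ht)) hγ0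
    linarith [hZc y hyZ]
  have : V y ≤ 0 := by
    by_contra hpos
    nlinarith
  linarith [hy z hz, hmin s]

/-- The discounted value, shifted to have minimum `0` and rescaled so that the scale `ρ` and the
norm of the function add up to `1`. The vanishing product records that the function has a
zero, in a form that passes to limits. -/
lemma exists_normalized_discounted [Nonempty S] (hP0 : ∀ s a t, 0 ≤ P s a t)
    (hP1 : ∀ s a, ∑ t, P s a t = 1) {K : ℝ} (hK : ∀ s, |c s| ≤ K) {Z : Set S} {γ : ℝ}
    (hγ0 : 0 ≤ γ) (hγ1 : γ < 1)
    (hZ : ∀ V, IsDiscountedValue c P γ V → ∀ z ∈ Z, ∀ s, V z ≤ V s) :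
    ∃ (ρ θ : ℝ) (u : S → ℝ), 0 ≤ ρ ∧ ρ + ‖u‖ = 1 ∧ |θ| ≤ K * ρ ∧ ∏ s, u s = 0 ∧
      (∀ z ∈ Z, ∀ s, u z ≤ u s) ∧
      ∀ s, θ + u s =
        min (ρ * c s + γ * ∑ t, P s false t * u t) (ρ * c s + γ * ∑ t, P s true t * u t) := by
  obtain ⟨V, hV⟩ := exists_isDiscountedValue (c := c) hP0 hP1 hγ0 hγ1
  obtain ⟨x, hx⟩ := Finite.exists_min V
  obtain ⟨y, hy⟩ := Finite.exists_max V
  set u : S → ℝ := fun s => V s - V x with hu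
  have hθle : |(1 - γ) * V x| ≤ K := by
    have hup : (1 - γ) * V y ≤ K := by
      have h1 : V y ≤ c y + γ * ∑ t, P y false t * V t := (hV y).trans_le (min_le_left _ _)
      have h2 := mul_le_mul_of_nonneg_left
        (average_le (hP0 y false) (hP1 y false) fun t _ => hy t) hγ0
      linarith [(abs_le.1 (hK y)).2]
    have hlow : -K + γ * V x ≤ V x := by
      conv_rhs => rw [hV x]
      have := fun a => mul_le_mul_of_nonneg_left (le_average (hP0 x a) (hP1 x a) hx) hγ0
      have h2 := (abs_le.1 (hK x)).1
      exact le_min (by linarith [this false]) (by linarith [this true])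
    exact abs_le.2 ⟨by linarith,
      (mul_le_mul_of_nonneg_left (hx y) (by linarith : (0 : ℝ) ≤ 1 - γ)).trans hup⟩
  have hr : 0 < 1 + ‖u‖ := by positivity
  set ρ : ℝ := (1 + ‖u‖)⁻¹ with hρ
  have hρ0 : 0 < ρ := inv_pos.2 hr
  refine ⟨ρ, ρ * ((1 - γ) * V x), ρ • u, hρ0.le, ?_, ?_, ?_, ?_, ?_⟩
  · rw [norm_smul, Real.norm_of_nonneg hρ0.le, ← mul_one_add, hρ, inv_mul_cancel₀ hr.ne']
  · rw [abs_mul, abs_of_pos hρ0, mul_comm]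
    exact mul_le_mul_of_nonneg_right hθle hρ0.le
  · exact Finset.prod_eq_zero (Finset.mem_univ x) (by simp [hu])
  · intro z hz s
    have := hZ V hV z hz s
    simp only [Pi.smul_apply, smul_eq_mul, hu]
    exact mul_le_mul_of_nonneg_left (by linarith) hρ0.le
  · intro s
    have hsum : ∀ a, ρ * c s + γ * ∑ t, P s a t * (ρ • u) t
        = ρ * (c s + γ * ∑ t, P s a t * V t) - ρ * (γ * V x) := by
      intro a
      have : ∑ t, P s a t * (ρ • u) t = ρ * (∑ t, P s a t * V t) - ρ * V x := by
        calc ∑ t, P s a t * (ρ • u) t = ∑ t, (ρ * (P s a t * V t) - P s a t * (ρ * V x)) :=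
              Finset.sum_congr rfl fun t _ => by
                simp only [Pi.smul_apply, smul_eq_mul, hu]; ring
          _ = _ := by
              rw [Finset.sum_sub_distrib, ← Finset.mul_sum, ← Finset.sum_mul, hP1, one_mul]
      rw [this]; ring
    rw [hsum, hsum, min_sub_sub_right, ← mul_min_of_nonneg _ _ hρ0.le, ← hV s]
    simp only [Pi.smul_apply, smul_eq_mul, hu]
    ring

/-- Vanishing discount: the average-cost optimality equation has a solution if `w = min_a P_a w` has
only constant solutions. The set `Z` of common minimizers of all discounted values weakens the
requirement to those `w` that are minimal on `Z`. -/
theorem exists_averageCost_solution [Nonempty S] (hP0 : ∀ s a t, 0 ≤ P s a t)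
    (hP1 : ∀ s a, ∑ t, P s a t = 1) (Z : Set S)
    (hZ : ∀ γ V, 0 ≤ γ → γ < 1 → IsDiscountedValue c P γ V → ∀ z ∈ Z, ∀ s, V z ≤ V s)
    (hconst : ∀ w : S → ℝ, (∀ s, w s = min (∑ t, P s false t * w t) (∑ t, P s true t * w t)) →
      (∀ z ∈ Z, ∀ s, w z ≤ w s) → ∀ s t, w s = w t) :
    ∃ (θ : ℝ) (V : S → ℝ), ∀ s, θ + V s =
      min (c s + ∑ t, P s false t * V t) (c s + ∑ t, P s true t * V t) := by
  obtain ⟨K, hK⟩ : ∃ K, ∀ s, |c s| ≤ K := by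
    obtain ⟨y, hy⟩ := Finite.exists_max fun s => |c s|
    exact ⟨_, hy⟩
  have hK0 : 0 ≤ K := (abs_nonneg _).trans (hK (Classical.arbitrary S))
  let γ : ℕ → ℝ := fun n => 1 - 1 / ((n : ℝ) + 1)
  have hγ0 : ∀ n, 0 ≤ γ n := fun n => by
    have : 1 / ((n : ℝ) + 1) ≤ 1 := by
      rw [div_le_one (by positivity)]; linarith [n.cast_nonneg (α := ℝ)]
    simpa [γ] using this
  have hγ1 : ∀ n, γ n < 1 := fun n => by
    have : 0 < 1 / ((n : ℝ) + 1) := by positivity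
    simp only [γ]; linarith
  have hγlim : Tendsto γ atTop (𝓝 1) := by
    simpa [γ] using (tendsto_one_div_add_atTop_nhds_zero_nat (𝕜 := ℝ)).const_sub 1
  choose ρ θ u hρ hsum hθ hprod hmin heq using fun n =>
    exists_normalized_discounted hP0 hP1 hK (hγ0 n) (hγ1 n)
      (fun V => hZ (γ n) V (hγ0 n) (hγ1 n))
  have hρ1 : ∀ n, ρ n ≤ 1 := fun n => by linarith [hsum n, norm_nonneg (u n)]
  have hbd : ∀ n, (ρ n, θ n, u n) ∈ Metric.closedBall (0 : ℝ × ℝ × (S → ℝ)) (1 + K) := by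
    intro n
    have h1 : ‖ρ n‖ ≤ 1 + K := by
      rw [Real.norm_of_nonneg (hρ n)]; linarith [hρ1 n]
    have h2 : ‖θ n‖ ≤ 1 + K := by
      rw [Real.norm_eq_abs]; nlinarith [hθ n, hρ1 n]
    have h3 : ‖u n‖ ≤ 1 + K := by linarith [hsum n, hρ n]
    rw [mem_closedBall_zero_iff]
    exact max_le h1 (max_le h2 h3)
  obtain ⟨⟨ρ', θ', w⟩, -, φ, hφ, hlim⟩ :=
    tendsto_subseq_of_bounded Metric.isBounded_closedBall hbd
  have hlρ : Tendsto (fun n => ρ (φ n)) atTop (𝓝 ρ') := (continuous_fst.tendsto _).comp hlim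
  have hlθ : Tendsto (fun n => θ (φ n)) atTop (𝓝 θ') :=
    ((continuous_fst.comp continuous_snd).tendsto _).comp hlim
  have hlu : Tendsto (fun n => u (φ n)) atTop (𝓝 w) :=
    ((continuous_snd.comp continuous_snd).tendsto _).comp hlim
  have hlγ : Tendsto (fun n => γ (φ n)) atTop (𝓝 1) := hγlim.comp hφ.tendsto_atTop
  have hlus : ∀ s, Tendsto (fun n => u (φ n) s) atTop (𝓝 (w s)) := tendsto_pi_nhds.1 hlu
  have hρ' : 0 ≤ ρ' := ge_of_tendsto' hlρ fun n => hρ _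
  have hsum' : ρ' + ‖w‖ = 1 :=
    tendsto_nhds_unique ((hlρ.add hlu.norm).congr fun n => hsum _) tendsto_const_nhds
  have hθ' : |θ'| ≤ K * ρ' := le_of_tendsto_of_tendsto' hlθ.abs (hlρ.const_mul K) fun n => hθ _
  have hprod' : ∏ s, w s = 0 :=
    tendsto_nhds_unique ((tendsto_finsetProd _ fun s _ => hlus s).congr fun n => hprod _)
      tendsto_const_nhds
  have hmin' : ∀ z ∈ Z, ∀ s, w z ≤ w s := fun z hz s =>
    le_of_tendsto_of_tendsto' (hlus z) (hlus s) fun n => hmin _ z hz s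
  have heq' : ∀ s, θ' + w s =
      min (ρ' * c s + ∑ t, P s false t * w t) (ρ' * c s + ∑ t, P s true t * w t) := by
    intro s
    have hT : ∀ a, Tendsto (fun n => ρ (φ n) * c s + γ (φ n) * ∑ t, P s a t * u (φ n) t) atTop
        (𝓝 (ρ' * c s + ∑ t, P s a t * w t)) := fun a => by
      have := (hlρ.mul_const (c s)).add
        (hlγ.mul (tendsto_finsetSum Finset.univ fun t _ => (hlus t).const_mul (P s a t)))
      simpa using this
    exact tendsto_nhds_unique ((hlθ.add (hlus s)).congr fun n => heq _ s)
      ((hT false).min (hT true))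
  rcases hρ'.eq_or_lt with h0 | hpos
  · -- Here `w` would be a constant function with a zero, although its norm is `1`.
    exfalso
    subst h0
    have hθ0 : θ' = 0 := by simpa using hθ'
    obtain ⟨x, -, hx⟩ := Finset.prod_eq_zero_iff.1 hprod'
    have hw := hconst w (fun s => by simpa [hθ0] using heq' s) hmin'
    have : w = 0 := funext fun s => (hw s x).trans hx
    simp [this] at hsum'
  · refine ⟨θ' / ρ', fun s => w s / ρ', fun s => ?_⟩
    have hs : ∀ a, c s + ∑ t, P s a t * (w t / ρ')
        = (ρ' * c s + ∑ t, P s a t * w t) / ρ' := fun a => by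
      simp only [← mul_div_assoc, ← Finset.sum_div]
      field_simp
    rw [hs, hs, min_div_div_right hpos.le, ← heq' s, add_div]


/-- For a solution of `w = min_a P_a w`, the set of maximizers is closed under all transitions. -/
lemma harmonic_max_step (hP0 : ∀ s a t, 0 ≤ P s a t) (hP1 : ∀ s a, ∑ t, P s a t = 1) {w : S → ℝ}
    (hw : ∀ s, w s = min (∑ t, P s false t * w t) (∑ t, P s true t * w t)) {K : ℝ}
    (hK : ∀ t, w t ≤ K) {s : S} (hs : w s = K) (a : Bool) {t : S} (ht : 0 < P s a t) :
    w t = K := by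
  refine eq_of_le_average (hP0 s a) (hP1 s a) hK ?_ ht
  rw [← hs, hw s]
  cases a
  exacts [min_le_left _ _, min_le_right _ _]

/-- For a solution of `w = min_a P_a w`, the set of minimizers is closed under some action. -/
lemma harmonic_min_step (hP0 : ∀ s a t, 0 ≤ P s a t) (hP1 : ∀ s a, ∑ t, P s a t = 1) {w : S → ℝ}
    (hw : ∀ s, w s = min (∑ t, P s false t * w t) (∑ t, P s true t * w t)) {k : ℝ}
    (hk : ∀ t, k ≤ w t) {s : S} (hs : w s = k) : ∃ a, ∀ t, 0 < P s a t → w t = k := by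
  rcases min_choice (∑ t, P s false t * w t) (∑ t, P s true t * w t) with h | h
  · exact ⟨false, fun t ht =>
      eq_of_average_le (hP0 s _) (hP1 s _) hk (by rw [← h, ← hw, hs]) ht⟩
  · exact ⟨true, fun t ht =>
      eq_of_average_le (hP0 s _) (hP1 s _) hk (by rw [← h, ← hw, hs]) ht⟩

end FiniteMDP

namespace VIAModel

variable {M : VIAModel}

/-! ### The transition probabilities -/

lemma bern_nonneg {r : ℝ} (h0 : 0 ≤ r) (h1 : r ≤ 1) (b : Bool) : 0 ≤ bern r b := by
  cases b <;> simp [bern, h0, h1]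

lemma bern_pos {r : ℝ} (h0 : 0 < r) (h1 : r < 1) (b : Bool) : 0 < bern r b := by
  cases b <;> simp [bern, h0, h1]

lemma exists_bern_pos {r : ℝ} : ∃ b, 0 < bern r b := by
  by_cases h : 0 < r
  · exact ⟨true, by simpa [bern] using h⟩
  · exact ⟨false, by simp only [bern]; norm_num; linarith⟩

lemma sourceProb_add_sourceProb_not (x : Bool) :
    M.sourceProb x x + M.sourceProb x (!x) = 1 := by
  cases x <;> simp [sourceProb]

/-- All parameters that stand for probabilities lie in `[0, 1]`, and energy arrivals are neither
impossible nor certain. -/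
structure IsStochastic (M : VIAModel) : Prop where
  beta_pos : 0 < M.β
  beta_lt_one : M.β < 1
  p_nonneg : 0 ≤ M.p
  p_le_one : M.p ≤ 1
  q_nonneg : 0 ≤ M.q
  q_le_one : M.q ≤ 1
  ps_nonneg : 0 ≤ M.ps
  ps_le_one : M.ps ≤ 1

namespace IsStochastic

variable (hM : M.IsStochastic)
include hM

lemma sourceProb_nonneg (x x' : Bool) : 0 ≤ M.sourceProb x x' := by
  cases x <;> cases x' <;>
    simp [sourceProb, hM.p_nonneg, hM.p_le_one, hM.q_nonneg, hM.q_le_one]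

lemma weight_nonneg (x b h x' : Bool) :
    0 ≤ bern M.β b * bern M.ps h * M.sourceProb x x' :=
  mul_nonneg (mul_nonneg (bern_nonneg hM.beta_pos.le hM.beta_lt_one.le b)
    (bern_nonneg hM.ps_nonneg hM.ps_le_one h)) (hM.sourceProb_nonneg x x')

lemma transProb_nonneg (s : M.State) (a : Action) (t : M.State) : 0 ≤ M.transProb s a t := by
  refine Finset.sum_nonneg fun b _ => Finset.sum_nonneg fun h _ => Finset.sum_nonneg fun x' _ => ?_
  split_ifs
  exacts [hM.weight_nonneg _ _ _ _, le_rfl]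

/-- Every energy arrival has positive probability, so only the channel state and the source have to
be admissible. -/
lemma transProb_pos (s : M.State) (a : Action) (b : Bool) {h x' : Bool} (hh : 0 < bern M.ps h)
    (hx : 0 < M.sourceProb s.2.1 x') : 0 < M.transProb s a (M.nextState s a b h x') := by
  have hnn : ∀ b' h' y, 0 ≤ if M.nextState s a b' h' y = M.nextState s a b h x' then
      bern M.β b' * bern M.ps h' * M.sourceProb s.2.1 y else 0 := fun b' h' y => by
    split_ifs
    exacts [hM.weight_nonneg _ _ _ _, le_rfl]
  refine Finset.sum_pos' (fun b' _ => Finset.sum_nonneg fun h' _ => Finset.sum_nonneg fun y _ =>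
    hnn b' h' y) ⟨b, Finset.mem_univ _, ?_⟩
  refine Finset.sum_pos' (fun h' _ => Finset.sum_nonneg fun y _ => hnn b h' y)
    ⟨h, Finset.mem_univ _, ?_⟩
  refine Finset.sum_pos' (fun y _ => hnn b h y) ⟨x', Finset.mem_univ _, ?_⟩
  rw [if_pos rfl]
  exact mul_pos (mul_pos (bern_pos hM.beta_pos hM.beta_lt_one b) hh) hx

end IsStochastic

lemma sum_transProb (M : VIAModel) (s : M.State) (a : Action) : ∑ t, M.transProb s a t = 1 := by
  have h : ∑ t, M.transProb s a t
      = ∑ b : Bool, ∑ h : Bool, ∑ x' : Bool, bern M.β b * bern M.ps h * M.sourceProb s.2.1 x' := by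
    unfold transProb
    rw [Finset.sum_comm]
    refine Finset.sum_congr rfl fun b _ => ?_
    rw [Finset.sum_comm]
    refine Finset.sum_congr rfl fun h _ => ?_
    rw [Finset.sum_comm]
    refine Finset.sum_congr rfl fun x' _ => ?_
    rw [Finset.sum_ite_eq, if_pos (Finset.mem_univ _)]
  rw [h]
  cases s.2.1 <;> simp [bern, sourceProb] <;> ring

lemma exists_nextState_of_transProb_ne_zero {s t : M.State} {a : Action}
    (h : M.transProb s a t ≠ 0) :
    ∃ b c x', M.sourceProb s.2.1 x' ≠ 0 ∧ M.nextState s a b c x' = t := by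
  obtain ⟨b, -, hb⟩ := Finset.exists_ne_zero_of_sum_ne_zero h
  obtain ⟨c, -, hc⟩ := Finset.exists_ne_zero_of_sum_ne_zero hb
  obtain ⟨x', -, hx⟩ := Finset.exists_ne_zero_of_sum_ne_zero hc
  by_cases heq : M.nextState s a b c x' = t
  · rw [if_pos heq] at hx
    exact ⟨b, c, x', right_ne_zero_of_mul hx, heq⟩
  · rw [if_neg heq] at hx
    exact absurd rfl hx

lemma cost_nonneg (M : VIAModel) (s : M.State) : 0 ≤ M.cost s := Nat.cast_nonneg _

/-! ### Reachability -/

/-- A set of states is closed if it cannot be left, whatever actions are played. As `0 < β < 1`,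
both energy arrivals `b` count as possible. -/
def IsClosedSet (M : VIAModel) (Q : Set M.State) : Prop :=
  ∀ s ∈ Q, ∀ a b h x', 0 < bern M.ps h → 0 < M.sourceProb s.2.1 x' → M.nextState s a b h x' ∈ Q

/-- If the source can always flip, a nonempty closed set contains all states of maximal age: fill
the battery, discharge it to the desired level by transmitting, and then idle without energy
arrivals while the source flips. -/
lemma IsClosedSet.mem_of_age_eq_max {Q : Set M.State} (hQ : M.IsClosedSet Q) (hne : Q.Nonempty)
    (hflip : ∀ x, 0 < M.sourceProb x (!x)) (t : M.State) (ht : t.2.2.val = M.Dmax) : t ∈ Q := by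
  obtain ⟨h, hh⟩ := exists_bern_pos (r := M.ps)
  have hstep : ∀ s ∈ Q, ∀ a b, M.nextState s a b h (!s.2.1) ∈ Q := fun s hs a b =>
    hQ s hs a b h _ hh (hflip _)
  have charge : ∀ k ≤ M.Emax, ∃ s ∈ Q, k ≤ s.1.val := by
    intro k
    induction k with
    | zero => exact fun _ => ⟨_, hne.some_mem, Nat.zero_le _⟩
    | succ k ih =>
      intro hk
      obtain ⟨s, hs, hks⟩ := ih (by omega)
      refine ⟨_, hstep s hs false true, ?_⟩
      simp only [nextState, nextBattery, transmits, Bool.false_and, Bool.toNat_true,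
        Bool.toNat_false]
      omega
  have discharge : ∀ k ≤ M.Emax, ∃ s ∈ Q, s.1.val = M.Emax - k := by
    intro k
    induction k with
    | zero =>
      intro _
      obtain ⟨s, hs, hks⟩ := charge M.Emax le_rfl
      exact ⟨s, hs, by have := s.1.isLt; omega⟩
    | succ k ih =>
      intro hk
      obtain ⟨s, hs, hks⟩ := ih (by omega)
      refine ⟨_, hstep s hs true false, ?_⟩
      have hpos : 0 < s.1.val := by omega
      simp only [nextState, nextBattery, transmits, Bool.true_and, hpos, decide_true,
        Bool.toNat_true, Bool.toNat_false]
      omega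
  have age : ∀ d ≤ M.Dmax, ∃ s ∈ Q, s.1.val = t.1.val ∧ d ≤ s.2.2.val := by
    intro d
    induction d with
    | zero =>
      intro _
      obtain ⟨s, hs, hks⟩ := discharge (M.Emax - t.1.val) (by omega)
      exact ⟨s, hs, by have := t.1.isLt; omega, Nat.zero_le _⟩
    | succ d ih =>
      intro hd
      obtain ⟨s, hs, hes, hds⟩ := ih (by omega)
      refine ⟨_, hstep s hs false false, ?_, ?_⟩
      · have := t.1.isLt
        simp only [nextState, nextBattery, transmits, Bool.false_and, Bool.toNat_false]
        omega
      · simp [nextState, nextVIA, transmits]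
        omega
  obtain ⟨s, hs, hes, hds⟩ := age M.Dmax le_rfl
  have hds' : s.2.2.val = M.Dmax := by have := s.2.2.isLt; omega
  by_cases hx : s.2.1 = t.2.1
  · have : s = t := Prod.ext (Fin.ext hes) (Prod.ext hx (Fin.ext (hds'.trans ht.symm)))
    exact this ▸ hs
  · have hx' : (!s.2.1) = t.2.1 := by
      revert hx; cases s.2.1 <;> cases t.2.1 <;> simp
    have : M.nextState s false false h (!s.2.1) = t := by
      refine Prod.ext (Fin.ext ?_) (Prod.ext hx' (Fin.ext ?_))
      · have := t.1.isLt
        simp only [nextState, nextBattery, transmits, Bool.false_and, Bool.toNat_false]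
        omega
      · simp [nextState, nextVIA, transmits, hds', ht]
    exact this ▸ hstep s hs false false

/-- If the source can always flip, no policy avoids the maximal age forever: without energy arrivals
and with flips of the source, every slot without a transmission raises the age, and transmissions
exhaust the battery. The lexicographic measure `e (Dmax + 1) + (Dmax - Δ)` makes this precise. -/
lemma exists_age_eq_max {N : Set M.State} (hne : N.Nonempty)
    (hN : ∀ s ∈ N, ∃ a, ∀ b h x', 0 < bern M.ps h → 0 < M.sourceProb s.2.1 x' →
      M.nextState s a b h x' ∈ N)
    (hflip : ∀ x, 0 < M.sourceProb x (!x)) : ∃ s ∈ N, s.2.2.val = M.Dmax := by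
  let m : M.State → ℕ := fun s => s.1.val * (M.Dmax + 1) + (M.Dmax - s.2.2.val)
  obtain ⟨s, hs, hmin⟩ := Set.exists_min_image N m N.toFinite hne
  refine ⟨s, hs, ?_⟩
  by_contra hlt
  have hlt' : s.2.2.val < M.Dmax := by have := s.2.2.isLt; omega
  obtain ⟨a, ha⟩ := hN s hs
  obtain ⟨h, hh⟩ := exists_bern_pos (r := M.ps)
  have hle := hmin _ (ha false h (!s.2.1) hh (hflip _))
  have hE := s.1.isLt
  by_cases htr : M.transmits s a = true
  · have hpos : 0 < s.1.val := by
      simp only [transmits, Bool.and_eq_true, decide_eq_true_eq] at htr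
      exact htr.2
    have hb : (M.nextState s a false h (!s.2.1)).1.val = s.1.val - 1 := by
      simp only [nextState, nextBattery, htr, Bool.toNat_true, Bool.toNat_false]
      omega
    simp only [m, hb] at hle
    obtain ⟨e, he⟩ : ∃ e, s.1.val = e + 1 := ⟨s.1.val - 1, by omega⟩
    rw [he, Nat.add_sub_cancel, Nat.succ_mul] at hle
    omega
  · have hb : (M.nextState s a false h (!s.2.1)).1.val = s.1.val := by
      simp only [nextState, nextBattery, htr, Bool.toNat_false]
      omega
    have hd : (M.nextState s a false h (!s.2.1)).2.2.val = s.2.2.val + 1 := by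
      simp [nextState, nextVIA, htr]
      omega
    simp only [m, hb, hd] at hle
    omega

/-- The states of age `0` whose source never moves. -/
def frozenFresh (M : VIAModel) : Set M.State :=
  {s | s.2.2.val = 0 ∧ M.sourceProb s.2.1 (!s.2.1) = 0}

lemma mem_frozenFresh_of_idle {z t : M.State} (hz : z ∈ M.frozenFresh)
    (h : M.transProb z false t ≠ 0) : t ∈ M.frozenFresh := by
  obtain ⟨b, c, x', hx', rfl⟩ := exists_nextState_of_transProb_ne_zero h
  obtain ⟨hz0, hzx⟩ := hz
  have : x' = z.2.1 := by
    by_contra hne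
    have : x' = !z.2.1 := by revert hne; cases x' <;> cases z.2.1 <;> simp
    exact hx' (this ▸ hzx)
  subst this
  exact ⟨by simp [nextState, nextVIA, transmits, hz0], hzx⟩

/-- If one of the two source transitions is impossible, a nonempty closed set contains a fresh state
with a frozen source: let the source reach the state that it cannot leave, collect energy, and
transmit successfully. -/
lemma IsClosedSet.exists_mem_frozenFresh (hM : M.IsStochastic) (hpq : M.p = 0 ∨ M.q = 0)
    (hps : 0 < M.ps) (hE : 1 ≤ M.Emax) {Q : Set M.State} (hQ : M.IsClosedSet Q)
    (hne : Q.Nonempty) : ∃ z ∈ Q, z ∈ M.frozenFresh := by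
  have hh : 0 < bern M.ps true := by simpa [bern] using hps
  obtain ⟨s, hs, hsx⟩ : ∃ s ∈ Q, M.sourceProb s.2.1 (!s.2.1) = 0 := by
    obtain ⟨s, hs⟩ := hne
    by_cases h0 : M.sourceProb s.2.1 (!s.2.1) = 0
    · exact ⟨s, hs, h0⟩
    · refine ⟨_, hQ s hs false true true (!s.2.1) hh
        ((hM.sourceProb_nonneg _ _).lt_of_ne' h0), ?_⟩
      change M.sourceProb (!s.2.1) (!(!s.2.1)) = 0
      revert h0
      cases s.2.1 <;> rcases hpq with h | h <;> simp [sourceProb, h]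
  have hstay : 0 < M.sourceProb s.2.1 s.2.1 := by
    have := M.sourceProb_add_sourceProb_not s.2.1
    linarith
  have hs' := hQ s hs false true true s.2.1 hh hstay
  have hpos : 0 < (M.nextState s false true true s.2.1).1.val := by
    simp only [nextState, nextBattery, transmits, Bool.false_and, Bool.toNat_true,
      Bool.toNat_false]
    omega
  refine ⟨_, hQ _ hs' true true true s.2.1 hh hstay, ?_, hsx⟩
  have htr : M.transmits (M.nextState s false true true s.2.1) true = true := by
    simp [transmits, hpos]
  have hx : (M.nextState s false true true s.2.1).2.1 = s.2.1 := rfl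
  generalize M.nextState s false true true s.2.1 = s₁ at htr hx
  simp [nextState, nextVIA, htr, hx]

/-! ### Existence of a solution of the Bellman equation -/

section Harmonic

variable {w : M.State → ℝ}
  (hw : ∀ s, w s = min (∑ t, M.transProb s false t * w t) (∑ t, M.transProb s true t * w t))
include hw

lemma isClosedSet_maximizers (hM : M.IsStochastic) {K : ℝ} (hK : ∀ t, w t ≤ K) :
    M.IsClosedSet {s | w s = K} := fun s hs a b _ _ hh hx =>
  FiniteMDP.harmonic_max_step hM.transProb_nonneg M.sum_transProb hw hK hs a
    (hM.transProb_pos s a b hh hx)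

lemma exists_action_minimizers (hM : M.IsStochastic) {k : ℝ} (hk : ∀ t, k ≤ w t) :
    ∀ s ∈ {s | w s = k}, ∃ a, ∀ b h x', 0 < bern M.ps h → 0 < M.sourceProb s.2.1 x' →
      M.nextState s a b h x' ∈ {s | w s = k} := fun s hs => by
  obtain ⟨a, ha⟩ := FiniteMDP.harmonic_min_step hM.transProb_nonneg M.sum_transProb hw hk hs
  exact ⟨a, fun b h x' hh hx => ha _ (hM.transProb_pos s a b hh hx)⟩

end Harmonic

theorem exists_bellman (hM : M.IsStochastic)
    (hnd : (0 < M.p ∧ 0 < M.q) ∨ (0 < M.ps ∧ 1 ≤ M.Emax)) :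
    ∃ (θ : ℝ) (V : M.State → ℝ), M.Bellman θ V := by
  by_cases hpq : 0 < M.p ∧ 0 < M.q
  · have hflip : ∀ x, 0 < M.sourceProb x (!x) := by
      rintro (_ | _) <;> simp [sourceProb, hpq]
    refine FiniteMDP.exists_averageCost_solution (c := M.cost) hM.transProb_nonneg
      M.sum_transProb ∅ (by simp) fun w hw _ => ?_
    obtain ⟨x, hx⟩ := Finite.exists_min w
    obtain ⟨y, hy⟩ := Finite.exists_max w
    obtain ⟨s, hs, hsD⟩ := exists_age_eq_max (N := {s | w s = w x}) ⟨x, rfl⟩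
      (exists_action_minimizers hw hM hx) hflip
    have hs' : w s = w y :=
      (isClosedSet_maximizers hw hM hy).mem_of_age_eq_max ⟨y, rfl⟩ hflip s hsD
    have hs : w s = w x := hs
    intro t t'
    linarith [hx t, hx t', hy t, hy t']
  · obtain ⟨hps, hE⟩ := hnd.resolve_left hpq
    have hpq' : M.p = 0 ∨ M.q = 0 := by
      by_contra! h
      exact hpq ⟨hM.p_nonneg.lt_of_ne' h.1, hM.q_nonneg.lt_of_ne' h.2⟩
    refine FiniteMDP.exists_averageCost_solution (c := M.cost) hM.transProb_nonneg
      M.sum_transProb M.frozenFresh (fun γ V hγ0 hγ1 hV z hz s => ?_) fun w hw hwZ => ?_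
    · exact hV.le_of_mem_costFree hM.transProb_nonneg M.sum_transProb M.cost_nonneg
        (fun z hz => by simp [cost, hz.1]) (fun z hz t ht => mem_frozenFresh_of_idle hz ht)
        hγ0 hγ1 hz s
    · obtain ⟨y, hy⟩ := Finite.exists_max w
      obtain ⟨z, hzy, hz⟩ := (isClosedSet_maximizers hw hM hy).exists_mem_frozenFresh hM hpq'
        hps hE ⟨y, rfl⟩
      have hzy : w z = w y := hzy
      intro t t'
      linarith [hwZ z hz t, hwZ z hz t', hy t, hy t']

/-! ### Verification -/

/-- `E[f(S_{n+1}) | S_1 = s]` under the policy `π`. -/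
noncomputable def expState (M : VIAModel) (π : Policy M) (s : M.State) (f : M.State → ℝ) (n : ℕ) :
    ℝ :=
  ∑ h : Hist M n, M.histProb π s n h * f h.last

lemma expState_zero (π : Policy M) (s : M.State) (f : M.State → ℝ) :
    M.expState π s f 0 = f s := by
  change ∑ h : M.State, (if h = s then (1 : ℝ) else 0) * f h = f s
  simp

lemma expState_succ (π : Policy M) (s : M.State) (f : M.State → ℝ) (n : ℕ) :
    M.expState π s f (n + 1) = ∑ h : Hist M n, M.histProb π s n h *
      ∑ a : Action, bern (π n h : ℝ) a * ∑ t, M.transProb h.last a t * f t := by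
  change ∑ h : Hist M n × Action × M.State,
    M.histProb π s n h.1 * bern (π n h.1 : ℝ) h.2.1 * M.transProb h.1.last h.2.1 h.2.2 * f h.2.2 = _
  rw [Fintype.sum_prod_type]
  refine Finset.sum_congr rfl fun h _ => ?_
  rw [Fintype.sum_prod_type, Finset.mul_sum]
  refine Finset.sum_congr rfl fun a _ => ?_
  simp only [Finset.mul_sum]
  exact Finset.sum_congr rfl fun t _ => by ring

lemma sum_bern (r : ℝ) : ∑ a : Bool, bern r a = 1 := by simp [bern]

lemma bern_unitInterval_nonneg (r : unitInterval) (a : Bool) : 0 ≤ bern (r : ℝ) a :=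
  bern_nonneg r.2.1 r.2.2 a

lemma histProb_nonneg (hM : M.IsStochastic) (π : Policy M) (s : M.State) :
    ∀ (n : ℕ) (h : Hist M n), 0 ≤ M.histProb π s n h
  | 0, h => by
    unfold histProb
    split_ifs <;> norm_num
  | n + 1, (h, a, t) => mul_nonneg (mul_nonneg (histProb_nonneg hM π s n h)
      (bern_unitInterval_nonneg _ a)) (hM.transProb_nonneg _ _ _)

lemma sum_histProb (π : Policy M) (s : M.State) (n : ℕ) :
    ∑ h : Hist M n, M.histProb π s n h = 1 := by
  induction n with
  | zero => simpa [expState] using expState_zero π s fun _ => 1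
  | succ n ih =>
    have := expState_succ π s (fun _ => 1) n
    simpa only [expState, mul_one, sum_transProb, sum_bern, ih] using this

lemma expState_le (hM : M.IsStochastic) (π : Policy M) (s : M.State) {f : M.State → ℝ} {K : ℝ}
    (hf : ∀ t, f t ≤ K) (n : ℕ) : M.expState π s f n ≤ K :=
  FiniteMDP.average_le (histProb_nonneg hM π s n) (sum_histProb π s n) fun h _ => hf h.last

lemma le_expState (hM : M.IsStochastic) (π : Policy M) (s : M.State) {f : M.State → ℝ} {k : ℝ}
    (hf : ∀ t, k ≤ f t) (n : ℕ) : k ≤ M.expState π s f n :=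
  FiniteMDP.le_average (histProb_nonneg hM π s n) (sum_histProb π s n) fun h => hf h.last

lemma bellmanTerm_average (V : M.State → ℝ) (s : M.State) (r : ℝ) :
    M.cost s + ∑ a : Action, bern r a * ∑ t, M.transProb s a t * V t
      = ∑ a : Action, bern r a * M.bellmanTerm V s a := by
  simp only [bellmanTerm, mul_add, Finset.sum_add_distrib, ← Finset.sum_mul, sum_bern, one_mul]

/-- The expectation of the right-hand side of the Bellman equation, with the action drawn by the
policy. -/
lemma expCost_add_expState_succ (π : Policy M) (s : M.State) (V : M.State → ℝ) (n : ℕ) :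
    M.expCost π s n + M.expState π s V (n + 1) = ∑ h : Hist M n, M.histProb π s n h *
      ∑ a : Action, bern (π n h : ℝ) a * M.bellmanTerm V h.last a := by
  rw [expState_succ, expCost, ← Finset.sum_add_distrib]
  refine Finset.sum_congr rfl fun h _ => ?_
  rw [← mul_add, bellmanTerm_average]

lemma add_expState (π : Policy M) (s : M.State) (V : M.State → ℝ) (θ : ℝ) (n : ℕ) :
    θ + M.expState π s V n = ∑ h : Hist M n, M.histProb π s n h * (θ + V h.last) := by
  simp only [mul_add, Finset.sum_add_distrib, ← Finset.sum_mul, sum_histProb, one_mul, expState]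

lemma Bellman.le_bellmanTerm {θ : ℝ} {V : M.State → ℝ} (hV : M.Bellman θ V) (s : M.State)
    (a : Action) : θ + V s ≤ M.bellmanTerm V s a := by
  rw [hV s]
  cases a
  exacts [min_le_left _ _, min_le_right _ _]

lemma Bellman.eq_bellmanTerm {θ : ℝ} {V : M.State → ℝ} (hV : M.Bellman θ V) {s : M.State}
    {a : Action} (ha : a ∈ M.argminActions V s) : θ + V s = M.bellmanTerm V s a :=
  le_antisymm (hV.le_bellmanTerm s a) ((le_min (ha false) (ha true)).trans (hV s).ge)

lemma bellman_telescope_le (hM : M.IsStochastic) {θ : ℝ} {V : M.State → ℝ} (hV : M.Bellman θ V)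
    (π : Policy M) (s : M.State) (T : ℕ) :
    T * θ + V s ≤ ∑ n ∈ Finset.range T, M.expCost π s n + M.expState π s V T := by
  induction T with
  | zero => simp [expState_zero]
  | succ T ih =>
    have h : θ + M.expState π s V T ≤ M.expCost π s T + M.expState π s V (T + 1) := by
      rw [add_expState, expCost_add_expState_succ]
      refine Finset.sum_le_sum fun h _ =>
        mul_le_mul_of_nonneg_left ?_ (histProb_nonneg hM π s T h)
      exact FiniteMDP.le_average (bern_unitInterval_nonneg _) (sum_bern _)
        (hV.le_bellmanTerm h.last)
    rw [Finset.sum_range_succ]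
    push_cast
    linarith

lemma bellman_telescope_eq {θ : ℝ} {V : M.State → ℝ} (hV : M.Bellman θ V) {μ : M.State → Action}
    (hμ : ∀ s, μ s ∈ M.argminActions V s) (s : M.State) (T : ℕ) :
    T * θ + V s = ∑ n ∈ Finset.range T, M.expCost (stationary μ) s n
      + M.expState (stationary μ) s V T := by
  induction T with
  | zero => simp [expState_zero]
  | succ T ih =>
    have h : θ + M.expState (stationary μ) s V T
        = M.expCost (stationary μ) s T + M.expState (stationary μ) s V (T + 1) := by
      rw [add_expState, expCost_add_expState_succ]
      refine Finset.sum_congr rfl fun h _ => ?_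
      rw [hV.eq_bellmanTerm (hμ h.last)]
      cases hc : μ h.last <;> simp [stationary, bern, hc]
    rw [Finset.sum_range_succ]
    push_cast
    linarith

lemma exists_abs_le (V : M.State → ℝ) : ∃ B, ∀ s, |V s| ≤ B := by
  obtain ⟨x, hx⟩ := Finite.exists_max fun s => |V s|
  exact ⟨_, hx⟩

lemma tendsto_const_add_div (θ B : ℝ) : Tendsto (fun T : ℕ => θ + B / T) atTop (𝓝 θ) := by
  simpa using (tendsto_const_div_atTop_nhds_zero_nat B).const_add θ

theorem Bellman.avgCost_stationary (hM : M.IsStochastic) {θ : ℝ} {V : M.State → ℝ}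
    (hV : M.Bellman θ V) {μ : M.State → Action} (hμ : ∀ s, μ s ∈ M.argminActions V s)
    (s : M.State) : M.avgCost (stationary μ) s = θ := by
  obtain ⟨B, hB⟩ := exists_abs_le V
  refine Tendsto.limsup_eq (tendsto_of_tendsto_of_tendsto_of_le_of_le'
    (tendsto_const_add_div θ (-(2 * B))) (tendsto_const_add_div θ (2 * B)) ?_ ?_)
  all_goals
    filter_upwards [eventually_gt_atTop 0] with T hT
    have hT' : (0 : ℝ) < T := by exact_mod_cast hT
    have h := bellman_telescope_eq hV hμ s T
    have h1 := expState_le hM (stationary μ) s (fun t => (abs_le.1 (hB t)).2) T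
    have h2 := le_expState hM (stationary μ) s (fun t => (abs_le.1 (hB t)).1) T
    have h3 := abs_le.1 (hB s)
    rw [one_div_mul_eq_div]
  · rw [le_div_iff₀ hT', add_mul, div_mul_cancel₀ _ hT'.ne']
    linarith
  · rw [div_le_iff₀ hT', add_mul, div_mul_cancel₀ _ hT'.ne']
    linarith

theorem Bellman.le_avgCost (hM : M.IsStochastic) {θ : ℝ} {V : M.State → ℝ} (hV : M.Bellman θ V)
    (π : Policy M) (s : M.State) : θ ≤ M.avgCost π s := by
  obtain ⟨B, hB⟩ := exists_abs_le V
  obtain ⟨K, hK⟩ := exists_abs_le M.cost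
  rw [← (tendsto_const_add_div θ (-(2 * B))).limsup_eq]
  refine limsup_le_limsup ?_ (tendsto_const_add_div θ _).isCoboundedUnder_le ?_
  · filter_upwards [eventually_gt_atTop 0] with T hT
    have hT' : (0 : ℝ) < T := by exact_mod_cast hT
    have h := bellman_telescope_le hM hV π s T
    have h1 := expState_le hM π s (fun t => (abs_le.1 (hB t)).2) T
    have h3 := abs_le.1 (hB s)
    rw [one_div_mul_eq_div, le_div_iff₀ hT', add_mul, div_mul_cancel₀ _ hT'.ne']
    linarith
  · -- Without an upper bound the limsup would be a junk value.
    refine isBoundedUnder_of_eventually_le (a := K) ?_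
    filter_upwards [eventually_gt_atTop 0] with T hT
    have hT' : (0 : ℝ) < T := by exact_mod_cast hT
    rw [one_div_mul_eq_div, div_le_iff₀ hT']
    calc ∑ n ∈ Finset.range T, M.expCost π s n ≤ ∑ _n ∈ Finset.range T, K :=
          Finset.sum_le_sum fun n _ => expState_le hM π s (fun t => (abs_le.1 (hK t)).2) n
      _ = K * T := by simp [mul_comm]

lemma exists_mem_argminActions (V : M.State → ℝ) (s : M.State) : ∃ a, a ∈ M.argminActions V s :=
  Finite.exists_min (M.bellmanTerm V s)

theorem Bellman.isLeast_avgCost (hM : M.IsStochastic) {θ : ℝ} {V : M.State → ℝ}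
    (hV : M.Bellman θ V) (s : M.State) : IsLeast (Set.range fun π : M.Policy => M.avgCost π s) θ := by
  choose μ hμ using exists_mem_argminActions V
  refine ⟨⟨stationary μ, hV.avgCost_stationary hM hμ s⟩, ?_⟩
  rintro _ ⟨π, rfl⟩
  exact hV.le_avgCost hM π s

end VIAModel

theorem proposition2 (M : VIAModel)
    (hβ0 : 0 < M.β) (hβ1 : M.β < 1)
    (hp0 : 0 ≤ M.p) (hp1 : M.p ≤ 1) (hq0 : 0 ≤ M.q) (hq1 : M.q ≤ 1)
    (hs0 : 0 ≤ M.ps) (hs1 : M.ps ≤ 1)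
    (hD : 1 ≤ M.Dmax)
    (hnd : (0 < M.p ∧ 0 < M.q) ∨ (0 < M.ps ∧ 1 ≤ M.Emax)) :
    ∃ θ : ℝ,
      (∀ s : M.State, IsLeast (Set.range fun π : M.Policy => M.avgCost π s) θ) ∧
      (∃ V : M.State → ℝ, M.Bellman θ V) ∧
      (∀ (θ' : ℝ) (V : M.State → ℝ), M.Bellman θ' V →
        θ' = θ ∧
        ∀ μ : M.State → VIAModel.Action, (∀ s : M.State, μ s ∈ M.argminActions V s) →
          ∀ s : M.State, M.avgCost (VIAModel.stationary μ) s = θ) := by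
  have hM : M.IsStochastic := ⟨hβ0, hβ1, hp0, hp1, hq0, hq1, hs0, hs1⟩
  obtain ⟨θ, V, hV⟩ := VIAModel.exists_bellman hM hnd
  refine ⟨θ, hV.isLeast_avgCost hM, ⟨V, hV⟩, fun θ' V' hV' => ?_⟩
  have hθ : θ' = θ :=
    (hV'.isLeast_avgCost hM (0, false, 0)).unique (hV.isLeast_avgCost hM (0, false, 0))
  exact ⟨hθ, fun μ hμ s => (hV'.avgCost_stationary hM hμ s).trans hθ⟩
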